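/- For $\alpha>-1$, $\beta\in\mathbb R$, $\mu\in\mathbb C$ and $t\ge 0$ let $$\varphi_\mu^{(\alpha,\beta)}(t)={}_2F_1\Bigl(\tfrac{\alpha+\beta+1-i\mu}{2},\tfrac{\alpha+\beta+1+i\mu}{2};\alpha+1;-\sinh^2 t\Bigr)$$ be the Jacobi function, where ${}_2F_1$ denotes the principal branch (on $\mathbb C\setminus[1,\infty)$) of the Gauss hypergeometric function. Fix constants $c>1$ and $d>0$. Then there exists a constant $C=C(c,d)$ such that for all $t\ge0$, $\beta>0$ and $\lambda\in\mathbb R$, with $\alpha:=c\beta+d$ and $\rho:=\alpha+\beta+1$, $$\Bigl|\varphi_{i\rho-\lambda}^{(c\beta+d,\beta)}(t)-e^{i\lambda\cdot\ln\sqrt{\cosh^2 t+\frac1c\sinh^2 t}}\Bigr|\le C\,\frac{|\lambda|\cdot\min(1,t)}{\sqrt{\beta}}.$$ -/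

import Mathlib

/-- `F` is an analytic continuation of the Gauss hypergeometric series `₂F₁(a, b; c; ·)` along the
straight segment from `0` to `z`: it is analytic at every point of the segment and agrees with the
sum of the power series near `0`. -/
def IsHypergeometricContinuation (a b c z : ℂ) (F : ℂ → ℂ) : Prop :=
  AnalyticOnNhd ℂ F (segment ℝ 0 z) ∧ F =ᶠ[nhds 0] (fun x : ℂ => ₂F₁ a b c x)

open Classical in
/-- The principal branch of the Gauss hypergeometric function `₂F₁(a, b; c; z)`. The plane cut along
`[1, ∞)` is star-shaped about `0`, so the principal branch at `z` is the value at `z` of the analytic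
continuation of the power series along the segment `[0, z]`. (Mathlib's `₂F₁` is only the sum of the
power series, which has no meaning for `‖z‖ > 1`.) -/
noncomputable def gaussHypergeometric (a b c z : ℂ) : ℂ :=
  if h : ∃ F : ℂ → ℂ, IsHypergeometricContinuation a b c z F then h.choose z else 0

/-- The analytic continuation is unique, so `gaussHypergeometric` is its value. -/
theorem gaussHypergeometric_eq {a b c z : ℂ} {F : ℂ → ℂ}
    (hF : IsHypergeometricContinuation a b c z F) : gaussHypergeometric a b c z = F z := by
  have h : ∃ F : ℂ → ℂ, IsHypergeometricContinuation a b c z F := ⟨F, hF⟩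
  have hG := h.choose_spec
  rw [gaussHypergeometric, dif_pos h]
  exact hG.1.eqOn_of_preconnected_of_eventuallyEq hF.1 (convex_segment 0 z).isPreconnected
    (left_mem_segment ℝ 0 z) (hG.2.trans hF.2.symm) (right_mem_segment ℝ 0 z)

/-- Inside the disc of convergence, `gaussHypergeometric` is the sum of the power series. -/
theorem gaussHypergeometric_eq_series {a b c z : ℂ}
    (hz : z ∈ Metric.eball (0 : ℂ) (ordinaryHypergeometricSeries ℂ a b c).radius) :
    gaussHypergeometric a b c z = ₂F₁ a b c z := by
  have hpos : 0 < (ordinaryHypergeometricSeries ℂ a b c).radius :=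
    lt_of_le_of_lt zero_le hz
  have hs := (ordinaryHypergeometricSeries ℂ a b c).hasFPowerSeriesOnBall hpos
  refine gaussHypergeometric_eq (F := fun x => ₂F₁ a b c x) ⟨?_, Filter.EventuallyEq.rfl⟩
  have hz' : ‖z‖ₑ < (ordinaryHypergeometricSeries ℂ a b c).radius := by
    simpa [Metric.mem_eball, edist_zero_right] using hz
  refine hs.analyticOnNhd.mono fun x hx => ?_
  obtain ⟨θ, hθ, rfl⟩ := (segment_eq_image ℝ (0 : ℂ) z ▸ hx :
    x ∈ (fun θ : ℝ => (1 - θ) • (0 : ℂ) + θ • z) '' Set.Icc (0 : ℝ) 1)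
  refine lt_of_le_of_lt ?_ hz'
  rw [edist_zero_right]
  refine enorm_le_iff_norm_le.2 ?_
  simp only [smul_zero, zero_add, norm_smul, Real.norm_eq_abs, abs_of_nonneg hθ.1]
  exact mul_le_of_le_one_left (norm_nonneg z) hθ.2

/-- The Jacobi function
`φ_μ^{(α,β)}(t) = ₂F₁((α+β+1-iμ)/2, (α+β+1+iμ)/2; α+1; -sinh² t)`. -/
noncomputable def jacobiFunction (α β : ℝ) (μ : ℂ) (t : ℝ) : ℂ :=
  gaussHypergeometric (((α : ℂ) + β + 1 - Complex.I * μ) / 2)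
    (((α : ℂ) + β + 1 + Complex.I * μ) / 2) ((α : ℂ) + 1) (-((Real.sinh t : ℂ) ^ 2))

/-- The number `ρ = α + β + 1`. -/
def jacobiRho (α β : ℝ) : ℝ := α + β + 1

/-! The Jacobi function `u` with parameter `iρ - λ` satisfies `u'' + A u' + (λ² - 2iρλ) u = 0`,
where `A = jacobiDrift α β`. To reach every `t`, including those where `-sinh² t` leaves the unit
disc, the series is continued to `Re z < 1/2` by the Pfaff transformation.

For `λ ≠ 0` put `D = u' / (iλ)`. Then `u' = iλ D` and `D' = -A D + (2ρ + iλ) u`, and `(u ± D) / 2`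
solve a two-state telegraph system with rates `A ∓ 2ρ`. These rates are nonnegative when `β ≤ α`, so
the `ℓ¹` norm does not grow (`norm_le_of_jacobi_system`). This gives `|u| ≤ 1` and stability under
forcing.

The comparison function is `v = exp(iλ ∫ q)`, where `q = limitSpeed c` is chosen so that `A q - 2ρ`
is bounded uniformly in `β`. The pair `(v, q v)` solves the system up to a residual of size `(K +
|λ|) / cosh²`. A corrector `g` with `g' = -A g + residual` absorbs it. Strong damping makes `g` of
order `1/α` (`exists_damped_solution`), and only `λ g` remains as forcing. Hence `|u - v| ≤ |λ| (K +
|λ|) tanh² t / (4α)`. This bound serves when `|λ| min(1,t) ≤ √β`; otherwise the trivial bound `2`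
suffices. -/

/-! ### The hypergeometric series and its differential equation -/

open Filter Topology in
/-- Termwise application of the Euler operator `z d/dz` to a power series on the unit disc. -/
theorem hasSum_euler_of_hasSum_unitBall {a : ℕ → ℂ} {f : ℂ → ℂ}
    (h : ∀ z ∈ Metric.ball (0 : ℂ) 1, HasSum (fun n => a n * z ^ n) (f z)) :
    DifferentiableOn ℂ f (Metric.ball 0 1) ∧
      ∀ z ∈ Metric.ball (0 : ℂ) 1, HasSum (fun n => n * a n * z ^ n) (z * deriv f z) := by
  set p := FormalMultilinearSeries.ofScalars ℂ a with hp
  have hrad : 1 ≤ p.radius := by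
    refine ENNReal.le_of_forall_nnreal_lt fun r hr => ?_
    have hr' : (r : ℝ) < 1 := by exact_mod_cast hr
    refine p.le_radius_of_tendsto (l := 0) ?_
    have h1 := (h (r : ℂ) (by simpa using hr')).summable.tendsto_atTop_zero.norm
    simpa [hp, FormalMultilinearSeries.ofScalars_norm] using h1
  have hF : HasFPowerSeriesOnBall f p 0 1 := by
    refine ⟨hrad, one_pos, fun {y} hy => ?_⟩
    have hy' : y ∈ Metric.ball (0 : ℂ) 1 := by
      rw [← Metric.eball_ofReal] ; simpa using hy
    simpa [hp, FormalMultilinearSeries.ofScalars_apply_eq, mul_comm] using h y hy'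
  have hd : DifferentiableOn ℂ f (Metric.ball 0 1) := by
    have := hF.differentiableOn
    rwa [← ENNReal.ofReal_one, Metric.eball_ofReal] at this
  refine ⟨hd, fun z hz => ?_⟩
  have hcoef (n : ℕ) : iteratedDeriv n f 0 = n.factorial * a n := by
    have h1 := hF.hasFPowerSeriesAt.eq_formalMultilinearSeries
      (hF.analyticAt.hasFPowerSeriesAt)
    have h2 := congrArg (fun q => FormalMultilinearSeries.coeff q n) h1
    simp only [hp, FormalMultilinearSeries.coeff_ofScalars] at h2
    have : (n.factorial : ℂ) ≠ 0 := by exact_mod_cast n.factorial_ne_zero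
    rw [h2]
    field_simp
  have hd' : DifferentiableOn ℂ (deriv f) (Metric.ball 0 1) := hd.deriv Metric.isOpen_ball
  have h3 := (Complex.hasSum_taylorSeries_on_ball (r := 1) hd' hz).mul_left z
  rw [← hasSum_nat_add_iff' 1]
  simp only [Finset.range_one, Finset.sum_singleton, Nat.cast_zero, zero_mul, sub_zero]
  convert! h3 using 2 with n
  rw [← iteratedDeriv_succ', hcoef, Nat.factorial_succ]
  have : (n.factorial : ℂ) ≠ 0 := by exact_mod_cast n.factorial_ne_zero
  push_cast
  simp only [smul_eq_mul, sub_zero]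
  field_simp
  ring

/-- For exceptional parameters the coefficients eventually vanish, also when `c` is a nonpositive
integer because division by zero gives zero; the radius is then infinite. -/
theorem one_le_radius_ordinaryHypergeometricSeries (a b c : ℂ) :
    1 ≤ (ordinaryHypergeometricSeries ℂ a b c).radius := by
  by_cases h : ∀ k : ℕ, (k : ℂ) ≠ -a ∧ (k : ℂ) ≠ -b ∧ (k : ℂ) ≠ -c
  · exact (ordinaryHypergeometricSeries_radius_eq_one ℂ a b c h).ge
  · simp only [not_forall, not_and_or, not_not] at h
    obtain ⟨k, hk⟩ := h
    have key : (ordinaryHypergeometricSeries ℂ a b c).radius = ⊤ := by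
      refine FormalMultilinearSeries.radius_eq_top_of_forall_image_add_eq_zero _ (k + 1) fun n => ?_
      refine ordinaryHypergeometricSeries_eq_zero_of_neg_nat a b c (n := n + (k + 1)) (k := k)
        hk (by omega)
    simp [key]

theorem hasSum_ordinaryHypergeometric (a b c : ℂ) {z : ℂ} (hz : z ∈ Metric.ball (0 : ℂ) 1) :
    HasSum (fun n => ordinaryHypergeometricCoefficient a b c n * z ^ n) (₂F₁ a b c z) := by
  have h1 := one_le_radius_ordinaryHypergeometricSeries a b c
  have h2 := ((ordinaryHypergeometricSeries ℂ a b c).hasFPowerSeriesOnBall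
    (one_pos.trans_le h1)).hasSum (y := z) (by
      refine Metric.eball_subset_eball h1 ?_
      rw [← ENNReal.ofReal_one, Metric.eball_ofReal]
      exact hz)
  rw [zero_add] at h2
  convert! h2 using 2 with n
  simp [ordinaryHypergeometricSeries, mul_comm]

theorem differentiableOn_ordinaryHypergeometric (a b c : ℂ) :
    DifferentiableOn ℂ (fun z : ℂ => ₂F₁ a b c z) (Metric.ball 0 1) :=
  (hasSum_euler_of_hasSum_unitBall fun _ hz => hasSum_ordinaryHypergeometric a b c hz).1

/-- `F` solves the hypergeometric differential equation at `z`. -/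
def HypergeometricODE (a b c : ℂ) (F : ℂ → ℂ) (z : ℂ) : Prop :=
  z * (1 - z) * deriv (deriv F) z + (c - (a + b + 1) * z) * deriv F z - a * b * F z = 0

theorem ordinaryHypergeometricCoefficient_succ (a b c : ℂ) (hc : ∀ n : ℕ, c + n ≠ 0) (n : ℕ) :
    (n + 1) * (n + c) * ordinaryHypergeometricCoefficient a b c (n + 1) =
      (n + a) * (n + b) * ordinaryHypergeometricCoefficient a b c n := by
  have h1 : (ascPochhammer ℂ n).eval c ≠ 0 := by
    rw [Ne, ascPochhammer_eval_eq_zero_iff]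
    rintro ⟨k, -, hk⟩
    exact hc k (by rw [hk]; ring)
  have h2 : (n.factorial : ℂ) ≠ 0 := by exact_mod_cast n.factorial_ne_zero
  have h3 : (n + 1 : ℂ) ≠ 0 := by exact_mod_cast n.succ_ne_zero
  have h4 := hc n
  simp only [ordinaryHypergeometricCoefficient, ascPochhammer_succ_eval, Nat.factorial_succ]
  push_cast
  field_simp
  ring

/-- With `θ = z d/dz`, the coefficient recurrence is `θ(θ + c - 1)F = z(θ + a)(θ + b)F`; dividing by
`z` gives the equation. -/
theorem hypergeometricODE_ordinaryHypergeometric {a b c : ℂ} (hc : ∀ n : ℕ, c + n ≠ 0) {z : ℂ}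
    (hz : z ∈ Metric.ball (0 : ℂ) 1) (hz0 : z ≠ 0) :
    HypergeometricODE a b c (fun z : ℂ => ₂F₁ a b c z) z := by
  set F : ℂ → ℂ := fun z => ₂F₁ a b c z with hF
  have h0 : ∀ z ∈ Metric.ball (0 : ℂ) 1, HasSum
    (fun n => ordinaryHypergeometricCoefficient a b c n * z ^ n) (F z) :=
      fun z hz => hasSum_ordinaryHypergeometric a b c hz
  obtain ⟨hd, h1⟩ := hasSum_euler_of_hasSum_unitBall h0
  have h2 := (hasSum_euler_of_hasSum_unitBall h1).2 z hz
  have hd' : deriv (fun z => z * deriv F z) z = deriv F z + z * deriv (deriv F) z := by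
    have := (hd.deriv Metric.isOpen_ball).differentiableAt (Metric.isOpen_ball.mem_nhds hz)
    rw [deriv_fun_mul differentiableAt_fun_id this]
    simp
  rw [hd'] at h2
  have hL := h2.add ((h1 z hz).mul_left (c - 1))
  have hR := ((h2.add ((h1 z hz).mul_left (a + b))).add ((h0 z hz).mul_left (a * b))).mul_left z
  -- `θ(θ + c - 1)` kills the constant term, so shifting the index by one matches the factor `z` on
  -- the other side.
  rw [← hasSum_nat_add_iff' 1] at hL
  simp only [Finset.range_one, Finset.sum_singleton, Nat.cast_zero, zero_mul, mul_zero, sub_zero,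
    add_zero] at hL
  have hE : HasSum (fun n : ℕ => ((n + 1 : ℕ) : ℂ) * (((n + 1 : ℕ) : ℂ) *
      ordinaryHypergeometricCoefficient a b c (n + 1)) * z ^ (n + 1) +
      (c - 1) * (((n + 1 : ℕ) : ℂ) * ordinaryHypergeometricCoefficient a b c (n + 1) *
        z ^ (n + 1))) (z * (z * (deriv F z + z * deriv (deriv F) z) + (a + b) * (z * deriv F z) +
          a * b * F z)) := by
    convert! hR using 2 with n
    have := ordinaryHypergeometricCoefficient_succ a b c hc n
    push_cast
    linear_combination z ^ (n + 1) * this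
  have := hL.unique hE
  refine mul_left_cancel₀ hz0 ?_
  linear_combination this

/-! ### Pfaff continuation to a half-plane -/

/-- The right-hand side of the Pfaff transformation, defined on the half-plane `Re z < 1/2`. -/
noncomputable def pfaffTransform (a b c z : ℂ) : ℂ :=
  (1 - z) ^ (-b) * ₂F₁ (c - a) b c (z / (z - 1))

theorem div_sub_one_mem_ball {z : ℂ} (hz : z.re < 1 / 2) : z / (z - 1) ∈ Metric.ball (0 : ℂ) 1 := by
  have h1 : z - 1 ≠ 0 := fun h => by
    have := congrArg Complex.re h
    simp at this
    linarith
  rw [mem_ball_zero_iff, norm_div, div_lt_one (norm_pos_iff.2 h1)]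
  refine lt_of_pow_lt_pow_left₀ 2 (norm_nonneg _) ?_
  rw [← Complex.normSq_eq_norm_sq, ← Complex.normSq_eq_norm_sq, Complex.normSq_apply,
    Complex.normSq_apply]
  simp
  nlinarith

theorem isOpen_re_lt_half : IsOpen {z : ℂ | z.re < 1 / 2} :=
  isOpen_lt Complex.continuous_re continuous_const

theorem hasDerivAt_one_sub_cpow (b : ℂ) {z : ℂ} (hz : z.re < 1 / 2) :
    HasDerivAt (fun z : ℂ => (1 - z) ^ (-b)) (b * (1 - z) ^ (-b) / (1 - z)) z := by
  have hs : 1 - z ∈ Complex.slitPlane := Or.inl (by simp; linarith)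
  have h0 : 1 - z ≠ 0 := Complex.slitPlane_ne_zero hs
  have := ((hasDerivAt_id z).const_sub 1).cpow_const (c := -b) hs
  convert! this using 1
  rw [id, Complex.cpow_sub _ _ h0, Complex.cpow_one]
  field_simp

theorem hasDerivAt_div_sub_one {z : ℂ} (hz : z.re < 1 / 2) :
    HasDerivAt (fun z : ℂ => z / (z - 1)) (-1 / (1 - z) ^ 2) z := by
  have h1 : z - 1 ≠ 0 := fun h => by
    have := congrArg Complex.re h
    simp at this
    linarith
  have h2 : 1 - z ≠ 0 := fun h => h1 (by linear_combination -h)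
  convert! (hasDerivAt_id z).div ((hasDerivAt_id z).sub_const 1) h1 using 1
  simp only [id]
  field_simp
  ring

theorem hasDerivAt_pfaffTransform (a b c : ℂ) {z : ℂ} (hz : z.re < 1 / 2) :
    HasDerivAt (pfaffTransform a b c)
      ((1 - z) ^ (-b) * (b / (1 - z) * ₂F₁ (c - a) b c (z / (z - 1)) -
        1 / (1 - z) ^ 2 * deriv (fun w : ℂ => ₂F₁ (c - a) b c w) (z / (z - 1)))) z := by
  have hH := ((differentiableOn_ordinaryHypergeometric (c - a) b c).differentiableAt
    (Metric.isOpen_ball.mem_nhds (div_sub_one_mem_ball hz))).hasDerivAt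
  have hcomp := HasDerivAt.comp z hH (hasDerivAt_div_sub_one hz)
  convert! (hasDerivAt_one_sub_cpow b hz).mul hcomp using 1
  simp only [Function.comp]
  ring

theorem differentiableOn_pfaffTransform (a b c : ℂ) :
    DifferentiableOn ℂ (pfaffTransform a b c) {z : ℂ | z.re < 1 / 2} :=
  fun _ hz => (hasDerivAt_pfaffTransform a b c hz).differentiableAt.differentiableWithinAt

theorem hypergeometricODE_pfaffTransform {a b c : ℂ} (hc : ∀ n : ℕ, c + n ≠ 0) {z : ℂ}
    (hz : z.re < 1 / 2) (hz0 : z ≠ 0) : HypergeometricODE a b c (pfaffTransform a b c) z := by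
  set H : ℂ → ℂ := fun w => ₂F₁ (c - a) b c w with hH
  have h2 : 1 - z ≠ 0 := fun h => by
    have := congrArg Complex.re h
    simp at this
    linarith
  have h1 : z - 1 ≠ 0 := fun h => h2 (by linear_combination -h)
  have hw := div_sub_one_mem_ball hz
  have hd1 := hasDerivAt_pfaffTransform a b c hz
  have hev : deriv (pfaffTransform a b c) =ᶠ[nhds z] fun z =>
      (1 - z) ^ (-b) * (b / (1 - z) * H (z / (z - 1)) - 1 / (1 - z) ^ 2 * deriv H (z / (z - 1))) := by
    filter_upwards [isOpen_re_lt_half.mem_nhds hz] with y hy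
    exact (hasDerivAt_pfaffTransform a b c hy).deriv
  have hHd := differentiableOn_ordinaryHypergeometric (c - a) b c
  have e0 := HasDerivAt.comp z (hHd.differentiableAt
    (Metric.isOpen_ball.mem_nhds hw)).hasDerivAt (hasDerivAt_div_sub_one hz)
  have e1 := HasDerivAt.comp z ((hHd.deriv Metric.isOpen_ball).differentiableAt
    (Metric.isOpen_ball.mem_nhds hw)).hasDerivAt (hasDerivAt_div_sub_one hz)
  have i1 : HasDerivAt (fun z : ℂ => b / (1 - z)) (b / (1 - z) ^ 2) z := by
    convert! (hasDerivAt_const z b).div ((hasDerivAt_id z).const_sub 1) h2 using 1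
    simp
  have i2 : HasDerivAt (fun z : ℂ => 1 / (1 - z) ^ 2) (2 / (1 - z) ^ 3) z := by
    convert! (hasDerivAt_const z (1 : ℂ)).div (((hasDerivAt_id z).const_sub 1).pow 2)
      (pow_ne_zero 2 h2) using 1
    simp
    field_simp
  have hd2 := (hasDerivAt_one_sub_cpow b hz).mul ((i1.mul e0).sub (i2.mul e1))
  have hdd := hev.deriv_eq.trans hd2.deriv
  have hode := hypergeometricODE_ordinaryHypergeometric (a := c - a) (b := b) hc hw
    (div_ne_zero hz0 h1)
  unfold HypergeometricODE at hode ⊢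
  rw [hdd, hd1.deriv]
  simp only [Function.comp, pfaffTransform, Pi.mul_apply, Pi.sub_apply]
  have hwz : z / (z - 1) = -z / (1 - z) := by field_simp; ring
  rw [hwz] at hode ⊢
  beta_reduce at hode
  generalize deriv (deriv fun w : ℂ => ₂F₁ (c - a) b c w) (-z / (1 - z)) = H2 at hode ⊢
  generalize deriv (fun w : ℂ => ₂F₁ (c - a) b c w) (-z / (1 - z)) = H1 at hode ⊢
  generalize (₂F₁ (c - a) b c (-z / (1 - z)) : ℂ) = H0 at hode ⊢
  generalize (1 - z) ^ (-b) = E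
  -- The equation at `z` is the one with parameters `c - a, b, c` at `z / (z - 1)`, times this
  -- factor.
  linear_combination (norm := skip) (-E / (1 - z)) * hode
  field_simp
  ring

open Filter Topology in
/-- The hypergeometric equation has at most one analytic solution near `0` with given value at `0`. -/
theorem eventuallyEq_of_hypergeometricODE {a b c : ℂ} (hc : ∀ n : ℕ, c + n ≠ 0) {F G : ℂ → ℂ}
    (hF : AnalyticAt ℂ F 0) (hG : AnalyticAt ℂ G 0) (h0 : F 0 = G 0)
    (hFo : ∀ᶠ z in 𝓝[≠] 0, HypergeometricODE a b c F z)
    (hGo : ∀ᶠ z in 𝓝[≠] 0, HypergeometricODE a b c G z) : F =ᶠ[𝓝 0] G := by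
  by_contra hne
  have hD : AnalyticAt ℂ (F - G) 0 := hF.sub hG
  have hnz : ¬ ∀ᶠ z in 𝓝 0, (F - G) z = 0 := fun h => hne (h.mono fun z hz => sub_eq_zero.1 hz)
  obtain ⟨n, h, hh, hh0, hev⟩ := hD.exists_eventuallyEq_pow_smul_nonzero_iff.2 hnz
  simp only [sub_zero, smul_eq_mul] at hev
  -- The difference vanishes at `0`, so its order `n` there is positive.
  obtain ⟨m, rfl⟩ : ∃ m, n = m + 1 := by
    refine Nat.exists_eq_succ_of_ne_zero fun hn => hh0 ?_
    have := hev.self_of_nhds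
    simpa [hn, h0] using this.symm
  set k : ℂ → ℂ := fun z => (m + 1) * h z + z * deriv h z with hk
  have hkan : AnalyticAt ℂ k 0 := (analyticAt_const.mul hh).add (analyticAt_id.mul hh.deriv)
  have hev1 : ∀ᶠ z in 𝓝 0, deriv (F - G) z = z ^ m * k z := by
    filter_upwards [hev.eventually_nhds, hh.eventually_analyticAt] with z hz hz2
    rw [EventuallyEq.deriv_eq (f := fun z => z ^ (m + 1) * h z) hz,
      deriv_fun_mul (by fun_prop) hz2.differentiableAt]
    simp [hk]
    ring
  have hev2 : ∀ᶠ z in 𝓝 0, z * deriv (deriv (F - G)) z = z ^ m * (m * k z + z * deriv k z) := by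
    filter_upwards [hev1.eventually_nhds, hkan.eventually_analyticAt] with z hz hz2
    rw [EventuallyEq.deriv_eq (f := fun z => z ^ m * k z) hz,
      deriv_fun_mul (by fun_prop) hz2.differentiableAt]
    rcases m with _ | m
    · simp
    · simp
      ring
  have hsub : ∀ᶠ z in 𝓝 0, deriv (F - G) z = deriv F z - deriv G z ∧
      deriv (deriv (F - G)) z = deriv (deriv F) z - deriv (deriv G) z := by
    have : ∀ᶠ z in 𝓝 0, deriv (F - G) z = deriv F z - deriv G z := by
      filter_upwards [hF.eventually_analyticAt, hG.eventually_analyticAt] with z h1 h2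
      exact deriv_sub h1.differentiableAt h2.differentiableAt
    filter_upwards [this, this.eventually_nhds, hF.deriv.eventually_analyticAt,
      hG.deriv.eventually_analyticAt] with z h1 h2 h3 h4
    refine ⟨h1, ?_⟩
    rw [EventuallyEq.deriv_eq (f := fun z => deriv F z - deriv G z) h2]
    exact deriv_sub h3.differentiableAt h4.differentiableAt
  -- The equation for `F - G` with the factor `z ^ m` removed; it extends continuously to `0`, where
  -- it gives the indicial condition `(c + m)(m + 1) h 0 = 0`.
  set L : ℂ → ℂ := fun z => (1 - z) * (m * k z + z * deriv k z) +
    (c - (a + b + 1) * z) * k z - a * b * (z * h z) with hL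
  have hLz : ∀ᶠ z in 𝓝[≠] 0, L z = 0 := by
    filter_upwards [hFo, hGo, hev.filter_mono nhdsWithin_le_nhds,
      hev1.filter_mono nhdsWithin_le_nhds, hev2.filter_mono nhdsWithin_le_nhds,
      hsub.filter_mono nhdsWithin_le_nhds, self_mem_nhdsWithin] with z e1 e2 e3 e4 e5 e6 e7
    unfold HypergeometricODE at e1 e2
    rw [e6.1] at e4
    rw [e6.2] at e5
    rw [Pi.sub_apply] at e3
    refine (mul_eq_zero.1 (?_ : z ^ m * L z = 0)).resolve_left (pow_ne_zero _ e7)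
    simp only [hL]
    linear_combination e1 - e2 - (1 - z) * e5 - (c - (a + b + 1) * z) * e4 + a * b * e3
  have hLan : ContinuousAt L 0 := by
    have h1 := hkan.continuousAt
    have h2 := hkan.deriv.continuousAt
    have h3 := hh.continuousAt
    simp only [hL]
    fun_prop
  have hL0 : L 0 = 0 := by
    have h1 : Tendsto L (𝓝[≠] 0) (𝓝 (L 0)) := hLan.tendsto.mono_left nhdsWithin_le_nhds
    exact tendsto_nhds_unique h1 (tendsto_const_nhds.congr' (hLz.mono fun _ h => h.symm))
  have hm : (m + 1 : ℂ) ≠ 0 := by exact_mod_cast m.succ_ne_zero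
  have hLval : L 0 = (c + m) * ((m + 1) * h 0) := by
    simp [hL, hk]
    ring
  have : (c + m) * ((m + 1) * h 0) = 0 := hLval ▸ hL0
  exact mul_ne_zero (hc m) (mul_ne_zero hm hh0) this

/-- The Pfaff transformation extends the hypergeometric series to `Re z < 1/2`. -/
theorem gaussHypergeometric_eq_pfaffTransform {a b c : ℂ} (hc : ∀ n : ℕ, c + n ≠ 0) {z : ℂ}
    (hz : z.re < 1 / 2) : gaussHypergeometric a b c z = pfaffTransform a b c z := by
  have han : ∀ y : ℂ, y.re < 1 / 2 → AnalyticAt ℂ (pfaffTransform a b c) y := fun y hy =>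
    (differentiableOn_pfaffTransform a b c).analyticAt (isOpen_re_lt_half.mem_nhds hy)
  have hball : Metric.ball (0 : ℂ) 1 ∈ nhds 0 := Metric.ball_mem_nhds 0 one_pos
  have hhalf : {z : ℂ | z.re < 1 / 2} ∈ nhds 0 := isOpen_re_lt_half.mem_nhds (by simp)
  refine gaussHypergeometric_eq ⟨fun y hy => han y ?_, ?_⟩
  · obtain ⟨θ, hθ, rfl⟩ := (segment_eq_image ℝ (0 : ℂ) z ▸ hy :
      y ∈ (fun θ : ℝ => (1 - θ) • (0 : ℂ) + θ • z) '' Set.Icc (0 : ℝ) 1)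
    simp only [smul_zero, zero_add, Complex.smul_re, smul_eq_mul]
    rcases le_total z.re 0 with h | h
    · linarith [mul_nonpos_of_nonneg_of_nonpos hθ.1 h]
    · linarith [mul_le_of_le_one_left h hθ.2]
  · refine eventuallyEq_of_hypergeometricODE (a := a) (b := b) hc (han 0 (by simp))
      ((differentiableOn_ordinaryHypergeometric a b c).analyticAt hball) (by simp [pfaffTransform])
      ?_ ?_
    · filter_upwards [mem_nhdsWithin_of_mem_nhds hhalf, self_mem_nhdsWithin] with y h1 h2
      exact hypergeometricODE_pfaffTransform hc h1 h2
    · filter_upwards [mem_nhdsWithin_of_mem_nhds hball, self_mem_nhdsWithin] with y h1 h2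
      exact hypergeometricODE_ordinaryHypergeometric hc h1 h2

/-! ### The Jacobi equation in the variable `t` -/

/-- The drift `(2α+1) coth t + (2β+1) tanh t` of the Jacobi operator. -/
noncomputable def jacobiDrift (α β t : ℝ) : ℝ :=
  (2 * α + 1) * (Real.cosh t / Real.sinh t) + (2 * β + 1) * (Real.sinh t / Real.cosh t)

/-- The Jacobi function with spectral parameter `iρ - λ` solves the Jacobi equation. -/
theorem exists_jacobiFunction_equation {α β : ℝ} (lam : ℝ) (hα : -1 < α) :
    ∃ u u₁ : ℝ → ℂ, (∀ t, u t = jacobiFunction α β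
        (Complex.I * (jacobiRho α β : ℂ) - (lam : ℂ)) t) ∧ u 0 = 1 ∧ u₁ 0 = 0 ∧ Continuous u₁ ∧
      (∀ t, HasDerivAt u (u₁ t) t) ∧
      ∀ t, 0 < t → HasDerivAt u₁ (-(jacobiDrift α β t : ℂ) * u₁ t -
        ((lam : ℂ) ^ 2 - 2 * Complex.I * jacobiRho α β * lam) * u t) t := by
  set a : ℂ := jacobiRho α β + Complex.I * lam / 2 with ha
  set b : ℂ := -(Complex.I * lam / 2) with hb
  set c : ℂ := α + 1 with hcdef
  have hc (n : ℕ) : c + n ≠ 0 := fun h => by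
    have := congrArg Complex.re h
    simp [hcdef] at this
    have hn : (0 : ℝ) ≤ n := n.cast_nonneg
    linarith
  set G := pfaffTransform a b c with hG
  have hre (t : ℝ) : (-(Real.sinh t : ℂ) ^ 2).re < 1 / 2 := by
    rw [← Complex.ofReal_pow, ← Complex.ofReal_neg, Complex.ofReal_re]
    linarith [sq_nonneg (Real.sinh t)]
  have hdG := differentiableOn_pfaffTransform a b c
  have hs (t : ℝ) : HasDerivAt (fun t : ℝ => -(Real.sinh t : ℂ) ^ 2)
      (-2 * (Real.sinh t : ℂ) * Real.cosh t) t := by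
    convert! ((Real.hasDerivAt_sinh t).ofReal_comp.pow 2).neg using 1
    simp
  have h1 (t : ℝ) : HasDerivAt (fun t : ℝ => G (-(Real.sinh t : ℂ) ^ 2))
      (deriv G (-(Real.sinh t : ℂ) ^ 2) * (-2 * (Real.sinh t : ℂ) * Real.cosh t)) t := by
    have hd : HasDerivAt G (deriv G (-(Real.sinh t : ℂ) ^ 2)) (-(Real.sinh t : ℂ) ^ 2) :=
      (hdG.differentiableAt (isOpen_re_lt_half.mem_nhds (hre t))).hasDerivAt
    exact hd.comp t (hs t)
  have h2 (t : ℝ) : HasDerivAt (fun t : ℝ => deriv G (-(Real.sinh t : ℂ) ^ 2))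
      (deriv (deriv G) (-(Real.sinh t : ℂ) ^ 2) * (-2 * (Real.sinh t : ℂ) * Real.cosh t)) t := by
    have hd : HasDerivAt (deriv G) (deriv (deriv G) (-(Real.sinh t : ℂ) ^ 2))
        (-(Real.sinh t : ℂ) ^ 2) :=
      ((hdG.deriv isOpen_re_lt_half).differentiableAt
        (isOpen_re_lt_half.mem_nhds (hre t))).hasDerivAt
    exact hd.comp t (hs t)
  have h3 (t : ℝ) : HasDerivAt (fun t : ℝ => -2 * (Real.sinh t : ℂ) * Real.cosh t)
      (-2 * ((Real.cosh t : ℂ) ^ 2 + (Real.sinh t : ℂ) ^ 2)) t := by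
    convert! ((Real.hasDerivAt_sinh t).ofReal_comp.const_mul (-2)).mul
      (Real.hasDerivAt_cosh t).ofReal_comp using 1
    ring
  have h4 (t : ℝ) := (h2 t).mul (h3 t)
  refine ⟨fun t => G (-(Real.sinh t : ℂ) ^ 2), fun t => deriv G (-(Real.sinh t : ℂ) ^ 2) *
    (-2 * (Real.sinh t : ℂ) * Real.cosh t), fun t => ?_, ?_, by simp, ?_, h1, fun t ht => ?_⟩
  · refine (gaussHypergeometric_eq_pfaffTransform hc (hre t)).symm.trans ?_
    rw [jacobiFunction]
    congr 1
    · simp only [ha, jacobiRho]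
      push_cast
      linear_combination (1 / 2 * (α + β + 1) : ℂ) * Complex.I_sq
    · simp only [hb, jacobiRho]
      push_cast
      linear_combination (-1 / 2 * (α + β + 1) : ℂ) * Complex.I_sq
  · simp [hG, pfaffTransform]
  · exact continuous_iff_continuousAt.2 fun t => (h4 t).continuousAt
  · have hsh : (Real.sinh t : ℂ) ≠ 0 := by exact_mod_cast (Real.sinh_pos_iff.2 ht).ne'
    have hch : (Real.cosh t : ℂ) ≠ 0 := by exact_mod_cast (Real.cosh_pos t).ne'
    have hid : (Real.cosh t : ℂ) ^ 2 = (Real.sinh t : ℂ) ^ 2 + 1 := by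
      exact_mod_cast Real.cosh_sq t
    have hode := hypergeometricODE_pfaffTransform (a := a) (b := b) hc (hre t)
      (neg_ne_zero.2 (pow_ne_zero 2 hsh))
    convert! h4 t using 1
    unfold HypergeometricODE at hode
    rw [← hG] at hode
    beta_reduce
    generalize deriv (deriv G) (-(Real.sinh t : ℂ) ^ 2) = G2 at hode ⊢
    generalize deriv G (-(Real.sinh t : ℂ) ^ 2) = G1 at hode ⊢
    generalize G (-(Real.sinh t : ℂ) ^ 2) = G0 at hode ⊢
    have hA : (jacobiDrift α β t : ℂ) * (-2 * (Real.sinh t : ℂ) * Real.cosh t) =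
        -2 * ((2 * α + 1) * (Real.cosh t : ℂ) ^ 2 + (2 * β + 1) * (Real.sinh t : ℂ) ^ 2) := by
      simp only [jacobiDrift, Complex.ofReal_add, Complex.ofReal_mul, Complex.ofReal_div,
        Complex.ofReal_one, Complex.ofReal_ofNat]
      field_simp
    have hab : 4 * a * b = (lam : ℂ) ^ 2 - 2 * Complex.I * jacobiRho α β * lam := by
      simp only [ha, hb]
      linear_combination (-(lam : ℂ) ^ 2) * Complex.I_sq
    have hab' : a + b = α + β + 1 := by
      simp only [ha, hb, jacobiRho]
      push_cast
      ring
    generalize (Real.cosh t : ℂ) = C at *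
    generalize (Real.sinh t : ℂ) = S at *
    rw [hab'] at hode
    rw [← hab]
    simp only [hcdef] at hode
    linear_combination -G1 * hA + 4 * hode + (-4 * S ^ 2 * G2 + (4 * α + 4) * G1) * hid

/-! ### Telegraph systems and stability -/

/-- Bounds the derivative of `√(‖Z‖² + ε²)`, a smooth substitute for `‖Z‖`, along one telegraph
equation. The rotation `iθZ` is orthogonal to `Z` and drops out; smoothing costs `κε/2`. -/
theorem real_inner_div_sqrt_le {κ σ ε θ : ℝ} (hκ : 0 ≤ κ) (hσ : 0 ≤ σ) (hε : 0 < ε) (Z W F : ℂ) :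
    inner ℝ Z (Complex.I * θ * Z + (-κ * Z + σ * W) / 2 + F) / Real.sqrt (‖Z‖ ^ 2 + ε ^ 2) ≤
      (-κ * ‖Z‖ + σ * ‖W‖) / 2 + κ * ε / 2 + ‖F‖ := by
  set S := Real.sqrt (‖Z‖ ^ 2 + ε ^ 2) with hS
  have hZ := norm_nonneg Z
  have hS2 : S ^ 2 = ‖Z‖ ^ 2 + ε ^ 2 := Real.sq_sqrt (by positivity)
  have hSpos : 0 < S := Real.sqrt_pos.2 (by positivity)
  have hZS : ‖Z‖ ≤ S := Real.le_sqrt_of_sq_le (by nlinarith [sq_nonneg ε])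
  have hSε : S ≤ ‖Z‖ + ε := by
    refine Real.sqrt_le_iff.2 ⟨by positivity, ?_⟩
    nlinarith [mul_nonneg hZ hε.le]
  have hsplit : inner ℝ Z (Complex.I * θ * Z + (-κ * Z + σ * W) / 2 + F) =
      -κ / 2 * ‖Z‖ ^ 2 + σ / 2 * inner ℝ Z W + inner ℝ Z F := by
    rw [← Complex.normSq_eq_norm_sq]
    simp [Complex.inner, Complex.normSq_apply]
    ring
  have h1 : inner ℝ Z W ≤ ‖Z‖ * ‖W‖ := real_inner_le_norm Z W
  have h2 : inner ℝ Z F ≤ ‖Z‖ * ‖F‖ := real_inner_le_norm Z F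
  have h3 : ‖Z‖ * ‖W‖ ≤ S * ‖W‖ := by gcongr
  have h4 : ‖Z‖ * ‖F‖ ≤ S * ‖F‖ := by gcongr
  have h5 : (‖Z‖ - ε) * S ≤ ‖Z‖ ^ 2 := by
    nlinarith [mul_nonneg hZ (sub_nonneg.2 hSε)]
  rw [div_le_iff₀ hSpos, hsplit]
  nlinarith [mul_le_mul_of_nonneg_left (h1.trans h3) hσ, mul_le_mul_of_nonneg_left h5 hκ]

theorem hasDerivAt_sqrt_norm_sq_add {Z : ℝ → ℂ} {Z' : ℂ} {x ε : ℝ} (hε : 0 < ε)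
    (h : HasDerivAt Z Z' x) :
    HasDerivAt (fun x => Real.sqrt (‖Z x‖ ^ 2 + ε ^ 2))
      (inner ℝ (Z x) Z' / Real.sqrt (‖Z x‖ ^ 2 + ε ^ 2)) x := by
  convert! (h.norm_sq.add_const (ε ^ 2)).sqrt (by positivity) using 1
  field_simp

/-- The `ℓ¹` contraction property of a two-state telegraph system with source terms. -/
theorem norm_add_norm_le_of_telegraph {lam s t M : ℝ} (hst : s ≤ t) {κ σ H H' : ℝ → ℝ}
    {U V F G : ℝ → ℂ}
    (hκ : ∀ x ∈ Set.Icc s t, 0 ≤ κ x) (hσ : ∀ x ∈ Set.Icc s t, 0 ≤ σ x)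
    (hM : ∀ x ∈ Set.Icc s t, κ x + σ x ≤ M)
    (hU : ∀ x ∈ Set.Icc s t, HasDerivAt U
      (Complex.I * lam * U x + (-κ x * U x + σ x * V x) / 2 + F x) x)
    (hV : ∀ x ∈ Set.Icc s t, HasDerivAt V
      (Complex.I * (-lam : ℝ) * V x + (-σ x * V x + κ x * U x) / 2 + G x) x)
    (hH : ∀ x ∈ Set.Icc s t, HasDerivAt H (H' x) x)
    (hFG : ∀ x ∈ Set.Icc s t, ‖F x‖ + ‖G x‖ ≤ H' x) :
    ‖U t‖ + ‖V t‖ ≤ ‖U s‖ + ‖V s‖ + (H t - H s) := by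
  have hM0 : 0 ≤ M := by
    have hs := Set.left_mem_Icc.2 hst
    linarith [hκ s hs, hσ s hs, hM s hs]
  have key : ∀ ε : ℝ, 0 < ε → ‖U t‖ + ‖V t‖ ≤
      ‖U s‖ + ‖V s‖ + (H t - H s) + ε * (2 + M / 2 * (t - s)) := by
    intro ε hε
    -- What one state loses the other gains, so the exchange terms cancel in the sum; the last term
    -- pays for the smoothing.
    set Φ : ℝ → ℝ := fun x => Real.sqrt (‖U x‖ ^ 2 + ε ^ 2) + Real.sqrt (‖V x‖ ^ 2 + ε ^ 2) -
      H x - M * ε / 2 * x with hΦ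
    have hd (x : ℝ) (hx : x ∈ Set.Icc s t) := (((hasDerivAt_sqrt_norm_sq_add hε (hU x hx)).add
      (hasDerivAt_sqrt_norm_sq_add hε (hV x hx))).sub (hH x hx)).sub
        ((hasDerivAt_id x).const_mul (M * ε / 2))
    have hanti : AntitoneOn Φ (Set.Icc s t) := by
      refine antitoneOn_of_hasDerivWithinAt_nonpos (convex_Icc s t)
        (fun x hx => (hd x hx).continuousAt.continuousWithinAt)
        (fun x hx => (hd x (interior_subset hx)).hasDerivWithinAt) fun x hx => ?_
      have hx := interior_subset hx
      have h1 := real_inner_div_sqrt_le (θ := lam) (hκ x hx) (hσ x hx) hε (U x) (V x) (F x)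
      have h2 := real_inner_div_sqrt_le (θ := -lam) (hσ x hx) (hκ x hx) hε (V x) (U x) (G x)
      have h3 := hFG x hx
      have h4 := mul_le_mul_of_nonneg_right (hM x hx) hε.le
      linarith
    have h := hanti (Set.left_mem_Icc.2 hst) (Set.right_mem_Icc.2 hst) hst
    simp only [hΦ] at h
    have hlow (z : ℂ) : ‖z‖ ≤ Real.sqrt (‖z‖ ^ 2 + ε ^ 2) :=
      Real.le_sqrt_of_sq_le (by nlinarith [sq_nonneg ε])
    have hup (z : ℂ) : Real.sqrt (‖z‖ ^ 2 + ε ^ 2) ≤ ‖z‖ + ε := by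
      refine Real.sqrt_le_iff.2 ⟨by positivity, ?_⟩
      nlinarith [mul_nonneg (norm_nonneg z) hε.le]
    linarith [hlow (U t), hlow (V t), hup (U s), hup (V s)]
  have hL : 0 < 2 + M / 2 * (t - s) := by
    have := mul_nonneg hM0 (sub_nonneg.2 hst)
    linarith
  refine le_of_forall_pos_le_add fun δ hδ => ?_
  have := key (δ / (2 + M / 2 * (t - s))) (by positivity)
  rwa [div_mul_cancel₀ _ hL.ne'] at this

/-- Equivalent to `(2α+1)(coth t - 1) ≥ (2β+1)(1 - tanh t)`, which follows from `coth t - 1 = (cosh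
t - sinh t)/sinh t ≥ (cosh t - sinh t)/cosh t`. -/
theorem two_mul_jacobiRho_le_jacobiDrift {α β t : ℝ} (hβ : -1 / 2 ≤ β) (hβα : β ≤ α) (ht : 0 < t) :
    2 * jacobiRho α β ≤ jacobiDrift α β t := by
  have hS := Real.sinh_pos_iff.2 ht
  have hC := Real.cosh_pos t
  have hSC := (Real.sinh_lt_cosh t).le
  have h1 : jacobiDrift α β t - 2 * jacobiRho α β =
      ((2 * α + 1) * ((Real.cosh t - Real.sinh t) * Real.cosh t) -
        (2 * β + 1) * ((Real.cosh t - Real.sinh t) * Real.sinh t)) /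
          (Real.sinh t * Real.cosh t) := by
    simp only [jacobiDrift, jacobiRho]
    field_simp
    ring
  have h2 : (2 * β + 1) * ((Real.cosh t - Real.sinh t) * Real.sinh t) ≤
      (2 * α + 1) * ((Real.cosh t - Real.sinh t) * Real.cosh t) := by
    have := sub_nonneg.2 hSC
    gcongr
    linarith
  have h3 : 0 ≤ jacobiDrift α β t - 2 * jacobiRho α β := by
    rw [h1]
    exact div_nonneg (sub_nonneg.2 h2) (by positivity)
  linarith

theorem continuousOn_jacobiDrift (α β : ℝ) : ContinuousOn (jacobiDrift α β) (Set.Ioi 0) := by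
  have h1 : ∀ t ∈ Set.Ioi (0 : ℝ), Real.sinh t ≠ 0 := fun t ht => (Real.sinh_pos_iff.2 ht).ne'
  have h2 : ∀ t ∈ Set.Ioi (0 : ℝ), Real.cosh t ≠ 0 := fun t _ => (Real.cosh_pos t).ne'
  unfold jacobiDrift
  exact (continuousOn_const.mul (Real.continuous_cosh.continuousOn.div
    Real.continuous_sinh.continuousOn h1)).add (continuousOn_const.mul
      (Real.continuous_sinh.continuousOn.div Real.continuous_cosh.continuousOn h2))

open Filter Topology in
/-- Stability of the first-order system equivalent to the Jacobi equation. -/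
theorem norm_le_of_jacobi_system {α β lam L : ℝ} (hβ : -1 / 2 ≤ β) (hβα : β ≤ α)
    {E D g : ℝ → ℂ} {H H' : ℝ → ℝ}
    (hE : ∀ t, 0 < t → HasDerivAt E (Complex.I * lam * (D t - g t)) t)
    (hD : ∀ t, 0 < t → HasDerivAt D (-(jacobiDrift α β t : ℂ) * D t +
      (2 * jacobiRho α β + Complex.I * lam) * E t) t)
    (hH : ∀ t, 0 < t → HasDerivAt H (H' t) t) (hg : ∀ t, 0 < t → |lam| * ‖g t‖ ≤ H' t)
    (hL : Tendsto (fun s => ‖E s‖ + ‖D s‖ - H s) (𝓝[>] 0) (𝓝 L)) {t : ℝ} (ht : 0 < t) :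
    ‖E t‖ ≤ L + H t := by
  have key : ∀ s, 0 < s → s ≤ t → ‖E t‖ - H t ≤ ‖E s‖ + ‖D s‖ - H s := by
    intro s hs hst
    have hpos : ∀ x ∈ Set.Icc s t, 0 < x := fun x hx => hs.trans_le hx.1
    -- The drift may be singular at `0`, so the estimate starts at `s > 0`, and `s → 0` is taken at
    -- the end.
    obtain ⟨M, hM⟩ := (isCompact_Icc (a := s) (b := t)).bddAbove_image
      ((continuousOn_jacobiDrift α β).mono hpos)
    have hA (x : ℝ) (hx : x ∈ Set.Icc s t) :=
      two_mul_jacobiRho_le_jacobiDrift hβ hβα (hpos x hx)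
    have hρ : 0 ≤ jacobiRho α β := by
      unfold jacobiRho
      linarith
    have h := norm_add_norm_le_of_telegraph (lam := lam) (M := 2 * M) hst
      (κ := fun x => jacobiDrift α β x - 2 * jacobiRho α β)
      (σ := fun x => jacobiDrift α β x + 2 * jacobiRho α β) (H := H) (H' := H')
      (U := fun x => (E x + D x) / 2) (V := fun x => (E x - D x) / 2)
      (F := fun x => -(Complex.I * lam * g x) / 2) (G := fun x => -(Complex.I * lam * g x) / 2)
      (fun x hx => sub_nonneg.2 (hA x hx)) (fun x hx => by linarith [hA x hx])
      (fun x hx => by linarith [hM (Set.mem_image_of_mem _ hx)])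
      (fun x hx => by
        convert! ((hE x (hpos x hx)).add (hD x (hpos x hx))).div_const 2 using 1
        push_cast
        ring)
      (fun x hx => by
        convert! ((hE x (hpos x hx)).sub (hD x (hpos x hx))).div_const 2 using 1
        push_cast
        ring)
      (fun x hx => hH x (hpos x hx))
      (fun x hx => by
        have := hg x (hpos x hx)
        simp
        linarith)
    have h1 : ‖E t‖ ≤ ‖(E t + D t) / 2‖ + ‖(E t - D t) / 2‖ := by
      refine le_trans (le_of_eq ?_) (norm_add_le _ _)
      congr 1
      ring
    have h2 : ‖(E s + D s) / 2‖ ≤ (‖E s‖ + ‖D s‖) / 2 := by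
      rw [norm_div, Complex.norm_two]
      gcongr
      exact norm_add_le _ _
    have h3 : ‖(E s - D s) / 2‖ ≤ (‖E s‖ + ‖D s‖) / 2 := by
      rw [norm_div, Complex.norm_two]
      gcongr
      exact norm_sub_le _ _
    linarith
  have hlim : ‖E t‖ - H t ≤ L := by
    refine ge_of_tendsto hL ?_
    filter_upwards [Ioc_mem_nhdsGT ht] with s hs
    exact key s hs.1 hs.2
  linarith

/-! ### The damped corrector -/

/-- The equation `g' = -A g + R` with damping `A = jacobiDrift α β` has a solution that is small
when `α` is large. -/
theorem exists_damped_solution {α β K : ℝ} (hα : 0 < α) (hβ : 0 < β) {R : ℝ → ℂ}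
    (hR : Continuous R) (hRK : ∀ t, 0 ≤ t → ‖R t‖ ≤ K / Real.cosh t ^ 2) :
    ∃ g : ℝ → ℂ, ∀ t, 0 < t → HasDerivAt g (-(jacobiDrift α β t : ℂ) * g t + R t) t ∧
      ‖g t‖ ≤ K / (2 * α) * (Real.sinh t / Real.cosh t ^ 3) := by
  have hK : 0 ≤ K := by simpa using (norm_nonneg _).trans (hRK 0 le_rfl)
  set p : ℝ := 2 * α + 1 with hp
  set q : ℝ := 2 * β + 1 with hq
  -- Integrating factor: `W' = A W` on `x > 0`, and `W 0 = 0`.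
  set W : ℝ → ℝ := fun x => Real.sinh x ^ p * Real.cosh x ^ q with hW
  set W' : ℝ → ℝ := fun x => Real.cosh x * p * Real.sinh x ^ (p - 1) * Real.cosh x ^ q +
    Real.sinh x ^ p * (Real.sinh x * q * Real.cosh x ^ (q - 1)) with hW'
  have hWd (x : ℝ) : HasDerivAt W (W' x) x :=
    ((Real.hasDerivAt_sinh x).rpow_const (Or.inr (by linarith))).mul
      ((Real.hasDerivAt_cosh x).rpow_const (Or.inr (by linarith)))
  have hWpos (x : ℝ) (hx : 0 < x) : 0 < W x :=
    mul_pos (Real.rpow_pos_of_pos (Real.sinh_pos_iff.2 hx) _)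
      (Real.rpow_pos_of_pos (Real.cosh_pos x) _)
  have hWA (x : ℝ) (hx : 0 < x) : W' x = W x * jacobiDrift α β x := by
    have hS := Real.sinh_pos_iff.2 hx
    have hC := Real.cosh_pos x
    simp only [hW, hW', jacobiDrift, Real.rpow_sub_one hS.ne', Real.rpow_sub_one hC.ne']
    rw [← hp, ← hq]
    field_simp
  have hWc : Continuous W := continuous_iff_continuousAt.2 fun x => (hWd x).continuousAt
  have hcont : Continuous fun x => (W x : ℂ) * R x := by fun_prop
  set J : ℝ → ℂ := fun t => ∫ x in (0 : ℝ)..t, (W x : ℂ) * R x with hJ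
  have hJd (t : ℝ) : HasDerivAt J ((W t : ℂ) * R t) t :=
    intervalIntegral.integral_hasDerivAt_right (hcont.intervalIntegrable _ _)
      (hcont.stronglyMeasurableAtFilter _ _) hcont.continuousAt
  -- A supersolution: `h' + A h ≥ 2α / cosh²`.
  set h : ℝ → ℝ := fun x => Real.sinh x / Real.cosh x ^ 3 with hh
  set h' : ℝ → ℝ := fun x => (Real.cosh x ^ 2 - 3 * Real.sinh x ^ 2) / Real.cosh x ^ 4 with hh'
  have hhd (x : ℝ) : HasDerivAt h (h' x) x := by
    have hC := (Real.cosh_pos x).ne'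
    convert! (Real.hasDerivAt_sinh x).div ((Real.hasDerivAt_cosh x).pow 3) (pow_ne_zero 3 hC) using 1
    simp only [hh', Pi.pow_apply]
    push_cast
    field_simp
  have hBd (x : ℝ) : HasDerivAt (fun x => K / (2 * α) * (W x * h x))
      (K / (2 * α) * (W' x * h x + W x * h' x)) x := ((hWd x).mul (hhd x)).const_mul _
  have hJb (t : ℝ) (ht : 0 < t) : ‖J t‖ ≤ K / (2 * α) * (W t * h t) := by
    refine image_norm_le_of_norm_deriv_right_le_deriv_boundary (a := 0) (b := t)
      (fun x _ => (hJd x).continuousAt.continuousWithinAt) (fun x _ => (hJd x).hasDerivWithinAt)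
      (by simp [hJ, hh]) hBd (fun x hx => ?_) (Set.right_mem_Icc.2 ht.le)
    rcases hx.1.eq_or_lt with rfl | hx0
    · have hp0 : p ≠ 0 := by positivity
      simp [hW, hh, Real.zero_rpow hp0]
    · have hS := Real.sinh_pos_iff.2 hx0
      have hC := Real.cosh_pos x
      have hCS := Real.cosh_sq x
      rw [hWA x hx0, norm_mul, Complex.norm_real, Real.norm_of_nonneg (hWpos x hx0).le]
      have hsuper : 1 / Real.cosh x ^ 2 ≤ 1 / (2 * α) * (jacobiDrift α β x * h x + h' x) := by
        have : 1 / (2 * α) * (jacobiDrift α β x * h x + h' x) - 1 / Real.cosh x ^ 2 =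
            (2 + 2 * β * Real.sinh x ^ 2) / (2 * α * Real.cosh x ^ 4) := by
          simp only [jacobiDrift, hh, hh']
          field_simp
          linear_combination (2 : ℝ) * hCS
        have h2 : 0 ≤ (2 + 2 * β * Real.sinh x ^ 2) / (2 * α * Real.cosh x ^ 4) := by positivity
        linarith
      calc W x * ‖R x‖ ≤ W x * (K / Real.cosh x ^ 2) :=
            mul_le_mul_of_nonneg_left (hRK x hx0.le) (hWpos x hx0).le
        _ = W x * K * (1 / Real.cosh x ^ 2) := by ring
        _ ≤ W x * K * (1 / (2 * α) * (jacobiDrift α β x * h x + h' x)) :=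
            mul_le_mul_of_nonneg_left hsuper (mul_nonneg (hWpos x hx0).le hK)
        _ = _ := by ring
  refine ⟨fun t => J t / W t, fun t ht => ⟨?_, ?_⟩⟩
  · have hW0 : (W t : ℂ) ≠ 0 := by exact_mod_cast (hWpos t ht).ne'
    convert! (hJd t).div (hWd t).ofReal_comp hW0 using 1
    rw [hWA t ht]
    push_cast
    field_simp
    ring
  · rw [norm_div, Complex.norm_real, Real.norm_of_nonneg (hWpos t ht).le,
      div_le_iff₀ (hWpos t ht)]
    linarith [hJb t ht]

/-! ### The limiting exponential and its residual -/

/-- The function `cosh² t + c⁻¹ sinh² t` whose square root is the limiting base. -/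
noncomputable def limitBaseSq (c t : ℝ) : ℝ := Real.cosh t ^ 2 + (1 / c) * Real.sinh t ^ 2

/-- The logarithmic derivative of `√(cosh² t + c⁻¹ sinh² t)`. -/
noncomputable def limitSpeed (c t : ℝ) : ℝ :=
  (1 + 1 / c) * (Real.sinh t * Real.cosh t) / limitBaseSq c t

theorem sq_cosh_le_limitBaseSq {c : ℝ} (hc : 0 < c) (t : ℝ) :
    Real.cosh t ^ 2 ≤ limitBaseSq c t := by
  have : 0 ≤ (1 / c) * Real.sinh t ^ 2 := by positivity
  unfold limitBaseSq
  linarith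

theorem limitBaseSq_pos {c : ℝ} (hc : 0 < c) (t : ℝ) : 0 < limitBaseSq c t :=
  (pow_pos (Real.cosh_pos t) 2).trans_le (sq_cosh_le_limitBaseSq hc t)

theorem hasDerivAt_limitBaseSq (c t : ℝ) :
    HasDerivAt (limitBaseSq c) (2 * (1 + 1 / c) * (Real.sinh t * Real.cosh t)) t := by
  convert! ((Real.hasDerivAt_cosh t).pow 2).add
    (((Real.hasDerivAt_sinh t).pow 2).const_mul (1 / c)) using 1
  push_cast
  ring

theorem hasDerivAt_log_sqrt_limitBaseSq {c : ℝ} (hc : 0 < c) (t : ℝ) :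
    HasDerivAt (fun t => Real.log (Real.sqrt (limitBaseSq c t))) (limitSpeed c t) t := by
  have hN := limitBaseSq_pos hc t
  have : (fun t => Real.log (Real.sqrt (limitBaseSq c t))) =
      fun t => Real.log (limitBaseSq c t) / 2 :=
    funext fun t => Real.log_sqrt (limitBaseSq_pos hc t).le
  rw [this]
  convert! ((hasDerivAt_limitBaseSq c t).log hN.ne').div_const 2 using 1
  unfold limitSpeed
  ring

theorem hasDerivAt_limitSpeed {c : ℝ} (hc : 0 < c) (t : ℝ) :
    HasDerivAt (limitSpeed c) ((1 + 1 / c) * (Real.cosh t ^ 2 - (1 / c) * Real.sinh t ^ 2) /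
      limitBaseSq c t ^ 2) t := by
  have hN := (limitBaseSq_pos hc t).ne'
  convert! (((Real.hasDerivAt_sinh t).mul (Real.hasDerivAt_cosh t)).const_mul (1 + 1 / c)).div
    (hasDerivAt_limitBaseSq c t) hN using 1
  rw [Pi.mul_apply]
  have hid := Real.cosh_sq t
  congr 1
  simp only [limitBaseSq]
  linear_combination (-(1 + 1 / c) * (Real.cosh t ^ 2 - (1 / c) * Real.sinh t ^ 2)) * hid

theorem sq_limitSpeed_sub_one {c : ℝ} (hc : 0 < c) (t : ℝ) :
    limitSpeed c t ^ 2 - 1 =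
      -((Real.cosh t ^ 2 - (1 / c) ^ 2 * Real.sinh t ^ 2) / limitBaseSq c t ^ 2) := by
  have hN := (limitBaseSq_pos hc t).ne'
  have hid := Real.cosh_sq t
  rw [limitSpeed, div_pow, div_sub_one (pow_ne_zero 2 hN), ← neg_div]
  congr 1
  simp only [limitBaseSq]
  linear_combination (-Real.cosh t ^ 2 + (1 / c) ^ 2 * Real.sinh t ^ 2) * hid

/-- The reason for the choice of `limitSpeed`: the terms of order `β` in `A q` and `2ρ` cancel
exactly, leaving a remainder free of `β`. -/
theorem jacobiDrift_mul_limitSpeed {c d β t : ℝ} (hc : 0 < c) (ht : 0 < t) :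
    jacobiDrift (c * β + d) β t * limitSpeed c t - 2 * jacobiRho (c * β + d) β =
      -((1 - (2 * d + 1) / c) / limitBaseSq c t) := by
  have hN := (limitBaseSq_pos hc t).ne'
  have hS := (Real.sinh_pos_iff.2 ht).ne'
  have hC := (Real.cosh_pos t).ne'
  have hid := Real.cosh_sq t
  have h1 : jacobiDrift (c * β + d) β t * limitSpeed c t = (1 + 1 / c) *
      ((2 * (c * β + d) + 1) * Real.cosh t ^ 2 + (2 * β + 1) * Real.sinh t ^ 2) /
        limitBaseSq c t := by
    simp only [jacobiDrift, limitSpeed]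
    field_simp
  rw [h1, div_sub' hN, ← neg_div]
  congr 1
  simp only [limitBaseSq, jacobiRho]
  field_simp
  linear_combination (2 * d + 1 - c) * hid

/-- The amplitude of the residual of `exp (iλ log √(cosh² + c⁻¹ sinh²))` in the Jacobi equation. -/
noncomputable def limitResidual (c d lam t : ℝ) : ℂ :=
  ((1 + 1 / c) * (Real.cosh t ^ 2 - (1 / c) * Real.sinh t ^ 2) / limitBaseSq c t ^ 2 -
      (1 - (2 * d + 1) / c) / limitBaseSq c t : ℝ) -
    Complex.I * lam *
      ((Real.cosh t ^ 2 - (1 / c) ^ 2 * Real.sinh t ^ 2) / limitBaseSq c t ^ 2 : ℝ)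

theorem continuous_limitResidual {c : ℝ} (hc : 0 < c) (d lam : ℝ) :
    Continuous (limitResidual c d lam) := by
  have hN : ∀ t, limitBaseSq c t ≠ 0 := fun t => (limitBaseSq_pos hc t).ne'
  have hNc : Continuous (limitBaseSq c) :=
    continuous_iff_continuousAt.2 fun t => (hasDerivAt_limitBaseSq c t).continuousAt
  have h1 : Continuous fun t => (1 + 1 / c) * (Real.cosh t ^ 2 - (1 / c) * Real.sinh t ^ 2) /
      limitBaseSq c t ^ 2 - (1 - (2 * d + 1) / c) / limitBaseSq c t :=
    (Continuous.div (by fun_prop) (by fun_prop) fun t => pow_ne_zero 2 (hN t)).sub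
      (continuous_const.div hNc hN)
  have h2 : Continuous fun t => (Real.cosh t ^ 2 - (1 / c) ^ 2 * Real.sinh t ^ 2) /
      limitBaseSq c t ^ 2 := Continuous.div (by fun_prop) (by fun_prop) fun t => pow_ne_zero 2 (hN t)
  exact (Complex.continuous_ofReal.comp h1).sub
    (continuous_const.mul (Complex.continuous_ofReal.comp h2))

theorem norm_limitResidual_le {c : ℝ} (hc : 1 ≤ c) (d lam t : ℝ) :
    ‖limitResidual c d lam t‖ ≤ (2 + |1 - (2 * d + 1) / c| + |lam|) / Real.cosh t ^ 2 := by
  have hc0 : 0 < c := one_pos.trans_le hc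
  have hN := limitBaseSq_pos hc0 t
  have hCN := sq_cosh_le_limitBaseSq hc0 t
  have hC2 : 0 < Real.cosh t ^ 2 := pow_pos (Real.cosh_pos t) 2
  have hic : 1 / c ≤ 1 := (div_le_one hc0).2 hc
  have hic0 : 0 < 1 / c := by positivity
  have hid := Real.cosh_sq t
  have hsq (x : ℝ) (hx0 : 0 ≤ x) (hx : x ≤ 1) :
      0 ≤ (Real.cosh t ^ 2 - x * Real.sinh t ^ 2) / limitBaseSq c t ^ 2 ∧
      (Real.cosh t ^ 2 - x * Real.sinh t ^ 2) / limitBaseSq c t ^ 2 ≤ 1 / Real.cosh t ^ 2 := by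
    constructor
    · refine div_nonneg ?_ (by positivity)
      nlinarith [mul_le_of_le_one_left (sq_nonneg (Real.sinh t)) hx]
    · rw [div_le_div_iff₀ (by positivity) hC2]
      have h1 : Real.cosh t ^ 2 - x * Real.sinh t ^ 2 ≤ Real.cosh t ^ 2 := by
        linarith [mul_nonneg hx0 (sq_nonneg (Real.sinh t))]
      nlinarith [mul_le_mul_of_nonneg_right h1 hC2.le, mul_self_le_mul_self hC2.le hCN]
  obtain ⟨a1, a2⟩ := hsq (1 / c) hic0.le hic
  obtain ⟨b1, b2⟩ := hsq ((1 / c) ^ 2) (by positivity) (pow_le_one₀ hic0.le hic)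
  have hinv : 1 / limitBaseSq c t ≤ 1 / Real.cosh t ^ 2 := one_div_le_one_div_of_le hC2 hCN
  have e1 : ‖(((1 + 1 / c) * (Real.cosh t ^ 2 - (1 / c) * Real.sinh t ^ 2) / limitBaseSq c t ^ 2 -
      (1 - (2 * d + 1) / c) / limitBaseSq c t : ℝ) : ℂ)‖ ≤
        (2 + |1 - (2 * d + 1) / c|) / Real.cosh t ^ 2 := by
    rw [Complex.norm_real, Real.norm_eq_abs, add_div (2 : ℝ)]
    refine (abs_sub _ _).trans (add_le_add ?_ ?_)
    · rw [mul_div_assoc, abs_of_nonneg (mul_nonneg (by linarith) a1)]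
      calc _ ≤ 2 * (1 / Real.cosh t ^ 2) := mul_le_mul (by linarith) a2 a1 (by norm_num)
        _ = _ := by ring
    · rw [abs_div, abs_of_pos hN, div_eq_mul_one_div, div_eq_mul_one_div _ (Real.cosh t ^ 2)]
      gcongr
  have e2 : ‖Complex.I * lam *
      ((Real.cosh t ^ 2 - (1 / c) ^ 2 * Real.sinh t ^ 2) / limitBaseSq c t ^ 2 : ℝ)‖ ≤
        |lam| / Real.cosh t ^ 2 := by
    rw [norm_mul, norm_mul, Complex.norm_I, Complex.norm_real, Complex.norm_real, one_mul,
      Real.norm_eq_abs, Real.norm_of_nonneg b1, div_eq_mul_one_div _ (Real.cosh t ^ 2)]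
    gcongr
  rw [add_div]
  exact (norm_sub_le _ _).trans (add_le_add e1 e2)

/-- With `q = limitSpeed c`, the right side is `q' + (A q - 2ρ) + iλ(q² - 1)`, the defect of `(v, q
v)` in the equation for `D`. -/
theorem limitResidual_eq {c d β t : ℝ} (lam : ℝ) (hc : 0 < c) (ht : 0 < t) :
    limitResidual c d lam t =
      ((1 + 1 / c) * (Real.cosh t ^ 2 - (1 / c) * Real.sinh t ^ 2) / limitBaseSq c t ^ 2 : ℝ) +
      (jacobiDrift (c * β + d) β t * limitSpeed c t - 2 * jacobiRho (c * β + d) β) +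
      Complex.I * lam * ((limitSpeed c t : ℂ) ^ 2 - 1) := by
  have h1 : (limitSpeed c t : ℂ) ^ 2 - 1 =
      ((-((Real.cosh t ^ 2 - (1 / c) ^ 2 * Real.sinh t ^ 2) / limitBaseSq c t ^ 2) : ℝ) : ℂ) := by
    exact_mod_cast sq_limitSpeed_sub_one hc t
  have h2 : ((jacobiDrift (c * β + d) β t * limitSpeed c t - 2 * jacobiRho (c * β + d) β : ℂ)) =
      ((-((1 - (2 * d + 1) / c) / limitBaseSq c t) : ℝ) : ℂ) := by
    exact_mod_cast jacobiDrift_mul_limitSpeed hc ht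
  rw [h1, h2, limitResidual, Complex.ofReal_sub, Complex.ofReal_neg, Complex.ofReal_neg]
  ring

/-! ### The uniform bound and the comparison bound -/

/-- Stability without forcing, with initial data `u = 1`, `D = 0`. -/
theorem norm_jacobiFunction_le_one {α β lam t : ℝ} (hβ : -1 / 2 ≤ β) (hβα : β ≤ α)
    (hlam : lam ≠ 0) (ht : 0 < t) :
    ‖jacobiFunction α β (Complex.I * (jacobiRho α β : ℂ) - (lam : ℂ)) t‖ ≤ 1 := by
  obtain ⟨u, u₁, hu, hu0, hu10, hc1, hd, hd1⟩ :=
    exists_jacobiFunction_equation (α := α) (β := β) lam (by linarith)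
  have hl : (lam : ℂ) ≠ 0 := by exact_mod_cast hlam
  have hcu : Continuous u := continuous_iff_continuousAt.2 fun t => (hd t).continuousAt
  rw [← hu]
  have h := norm_le_of_jacobi_system (α := α) (β := β) (lam := lam) (L := 1) hβ hβα (E := u)
    (D := fun t => u₁ t / (Complex.I * lam)) (g := fun _ => 0) (H := fun _ => 0) (H' := fun _ => 0)
    (fun t _ => by
      convert! hd t using 1
      field_simp [Complex.I_ne_zero]
      ring)
    (fun t ht => by
      convert! (hd1 t ht).div_const (Complex.I * lam) using 1
      field_simp [Complex.I_ne_zero]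
      linear_combination (lam : ℂ) ^ 2 * u t * Complex.I_sq)
    (fun t _ => hasDerivAt_const t 0) (by simp) ?_ ht
  · simpa using h
  · have hcont : Continuous fun s => ‖u s‖ + ‖u₁ s / (Complex.I * lam)‖ - 0 := by fun_prop
    have := hcont.tendsto 0
    simp only [hu0, hu10, zero_div, norm_zero, norm_one, add_zero, sub_zero] at this
    simpa using this.mono_left nhdsWithin_le_nhds

-- Stability applied to the difference of the two solutions, with the corrector added to its second
-- component. The initial data vanish, so only the integrated forcing remains.
open Filter Topology in
theorem norm_jacobiFunction_sub_exp_le {c d β lam t : ℝ} (hc : 1 ≤ c) (hd : 0 < d) (hβ : 0 < β)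
    (hlam : lam ≠ 0) (ht : 0 < t) :
    ‖jacobiFunction (c * β + d) β
          (Complex.I * (jacobiRho (c * β + d) β : ℂ) - (lam : ℂ)) t
        - Complex.exp (Complex.I * (lam : ℂ) * (Real.log (Real.sqrt (limitBaseSq c t)) : ℂ))‖ ≤
      |lam| * (2 + |1 - (2 * d + 1) / c| + |lam|) / (4 * (c * β + d)) *
        (Real.sinh t / Real.cosh t) ^ 2 := by
  have hc0 : 0 < c := one_pos.trans_le hc
  set α := c * β + d with hα
  have hα0 : 0 < α := by positivity
  have hβα : β ≤ α := by nlinarith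
  set K := 2 + |1 - (2 * d + 1) / c| + |lam| with hK
  obtain ⟨u, u₁, hu, hu0, hu10, hc1, hud, hud1⟩ :=
    exists_jacobiFunction_equation (α := α) (β := β) lam (by linarith)
  have hl : (lam : ℂ) ≠ 0 := by exact_mod_cast hlam
  set v : ℝ → ℂ := fun t =>
    Complex.exp (Complex.I * (lam : ℂ) * (Real.log (Real.sqrt (limitBaseSq c t)) : ℂ)) with hv
  have hvd (t : ℝ) : HasDerivAt v (Complex.I * lam * limitSpeed c t * v t) t := by
    convert! ((hasDerivAt_log_sqrt_limitBaseSq hc0 t).ofReal_comp.const_mul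
      (Complex.I * (lam : ℂ))).cexp using 1
    ring
  have hvn (t : ℝ) : ‖v t‖ = 1 := by
    rw [hv]
    beta_reduce
    rw [mul_assoc, mul_comm, ← Complex.ofReal_mul]
    exact Complex.norm_exp_ofReal_mul_I _
  have hvc : Continuous v := continuous_iff_continuousAt.2 fun t => (hvd t).continuousAt
  have huc : Continuous u := continuous_iff_continuousAt.2 fun t => (hud t).continuousAt
  have hqc : Continuous (limitSpeed c) :=
    continuous_iff_continuousAt.2 fun t => (hasDerivAt_limitSpeed hc0 t).continuousAt
  obtain ⟨g, hg⟩ := exists_damped_solution (K := K) hα0 hβ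
    (R := fun t => limitResidual c d lam t * v t) ((continuous_limitResidual hc0 d lam).mul hvc)
    (fun t _ => by
      rw [norm_mul, hvn, mul_one]
      exact norm_limitResidual_le hc d lam t)
  have hch (t : ℝ) : Real.cosh t ≠ 0 := (Real.cosh_pos t).ne'
  rw [← hu]
  have h := norm_le_of_jacobi_system (α := α) (β := β) (lam := lam) (L := 0) (by linarith) hβα
    (E := fun t => u t - v t) (D := fun t => u₁ t / (Complex.I * lam) - limitSpeed c t * v t + g t)
    -- `sinh / cosh³` is the derivative of `tanh² / 2`, whence the `4α`.
    (g := g) (H := fun t => |lam| * K / (4 * α) * (Real.sinh t / Real.cosh t) ^ 2)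
    (H' := fun t => |lam| * (K / (2 * α) * (Real.sinh t / Real.cosh t ^ 3)))
    (fun t _ => by
      convert! (hud t).sub (hvd t) using 1
      field_simp [Complex.I_ne_zero]
      ring)
    (fun t ht => by
      convert! (((hud1 t ht).div_const (Complex.I * lam)).sub
        ((hasDerivAt_limitSpeed hc0 t).ofReal_comp.mul (hvd t))).add (hg t ht).1 using 1
      rw [limitResidual_eq (β := β) lam hc0 ht]
      generalize Complex.ofReal ((1 + 1 / c) * (Real.cosh t ^ 2 - (1 / c) * Real.sinh t ^ 2) /
        limitBaseSq c t ^ 2) = q'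
      field_simp [Complex.I_ne_zero]
      linear_combination (lam : ℂ) ^ 2 * u t * Complex.I_sq)
    (fun t _ => by
      convert! (((Real.hasDerivAt_sinh t).div (Real.hasDerivAt_cosh t) (hch t)).pow 2).const_mul
        (|lam| * K / (4 * α)) using 1
      have hid := Real.cosh_sq t
      have hC := hch t
      have : Real.cosh t * Real.cosh t - Real.sinh t * Real.sinh t = 1 := by
        linear_combination hid
      rw [this, Pi.div_apply]
      push_cast
      field_simp
      ring)
    (fun t ht => mul_le_mul_of_nonneg_left (hg t ht).2 (abs_nonneg _)) ?_ ht
  · simpa using h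
  · have hv0 : v 0 = 1 := by simp [hv, limitBaseSq]
    have hg0 : Tendsto (fun t => ‖g t‖) (𝓝[>] 0) (𝓝 0) := by
      have hcont : Continuous fun t => K / (2 * α) * (Real.sinh t / Real.cosh t ^ 3) :=
        continuous_const.mul (Real.continuous_sinh.div (Real.continuous_cosh.pow 3)
          fun t => pow_ne_zero 3 (hch t))
      have := (hcont.tendsto 0).mono_left (nhdsWithin_le_nhds (s := Set.Ioi 0))
      simp only [Real.sinh_zero, zero_div, mul_zero] at this
      refine squeeze_zero' (Eventually.of_forall fun _ => norm_nonneg _) ?_ this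
      filter_upwards [self_mem_nhdsWithin] with t ht using (hg t ht).2
    have hgz : Tendsto g (𝓝[>] 0) (𝓝 0) := tendsto_zero_iff_norm_tendsto_zero.2 hg0
    have hE : Tendsto (fun t => u t - v t) (𝓝[>] 0) (𝓝 0) := by
      have hcont : Continuous fun t => u t - v t := huc.sub hvc
      have := (hcont.tendsto 0).mono_left (nhdsWithin_le_nhds (s := Set.Ioi 0))
      simpa [hu0, hv0] using this
    have hD : Tendsto (fun t => u₁ t / (Complex.I * lam) - limitSpeed c t * v t) (𝓝[>] 0) (𝓝 0) := by
      have hcont : Continuous fun t => u₁ t / (Complex.I * lam) - limitSpeed c t * v t := by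
        fun_prop
      have := (hcont.tendsto 0).mono_left (nhdsWithin_le_nhds (s := Set.Ioi 0))
      simpa [hu10, limitSpeed] using this
    have hH : Tendsto (fun t => |lam| * K / (4 * α) * (Real.sinh t / Real.cosh t) ^ 2)
        (𝓝[>] 0) (𝓝 0) := by
      have hcont : Continuous fun t => |lam| * K / (4 * α) * (Real.sinh t / Real.cosh t) ^ 2 :=
        continuous_const.mul ((Real.continuous_sinh.div Real.continuous_cosh hch).pow 2)
      have := (hcont.tendsto 0).mono_left (nhdsWithin_le_nhds (s := Set.Ioi 0))
      simpa using this
    simpa using (hE.norm.add (hD.add hgz).norm).sub hH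

/-- Covers `λ = 0`, where division by `iλ` is impossible; the second upper parameter is then `0` and
the series reduces to its first term. -/
theorem jacobiFunction_I_mul_jacobiRho {α β t : ℝ} (hα : -1 < α) :
    jacobiFunction α β (Complex.I * (jacobiRho α β : ℂ) - ((0 : ℝ) : ℂ)) t = 1 := by
  obtain ⟨c, hc⟩ : ∃ c : ℂ, c = α + 1 := ⟨_, rfl⟩
  have hcn (n : ℕ) : c + n ≠ 0 := fun h => by
    have := congrArg Complex.re h
    simp [hc] at this
    have hn : (0 : ℝ) ≤ n := n.cast_nonneg
    linarith
  have hb : ((α : ℂ) + β + 1 + Complex.I * (Complex.I * (jacobiRho α β : ℂ) - ((0 : ℝ) : ℂ))) / 2 =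
      0 := by
    simp only [jacobiRho]
    push_cast
    linear_combination (1 / 2 * (α + β + 1) : ℂ) * Complex.I_sq
  rw [jacobiFunction, hb, ← hc, gaussHypergeometric_eq_pfaffTransform hcn (by
    rw [← Complex.ofReal_pow, ← Complex.ofReal_neg, Complex.ofReal_re]
    linarith [sq_nonneg (Real.sinh t)])]
  have h1 (x y : ℂ) : (₂F₁ x 0 c y : ℂ) = 1 := by
    rw [ordinaryHypergeometric_eq_tsum]
    beta_reduce
    rw [tsum_eq_single 0 fun n hn => by simp [hn]]
    simp
  simp [pfaffTransform, h1]

/-! ### Conclusion -/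

theorem sinh_div_cosh_le_min {t : ℝ} (ht : 0 ≤ t) : Real.sinh t / Real.cosh t ≤ min 1 t := by
  have hC := Real.cosh_pos t
  refine le_min ((div_le_one hC).2 (Real.sinh_lt_cosh t).le) ?_
  rw [div_le_iff₀ hC]
  have hmono : MonotoneOn (fun t => t * Real.cosh t - Real.sinh t) (Set.Ici 0) := by
    have hd (x : ℝ) : HasDerivAt (fun t => t * Real.cosh t - Real.sinh t)
        (1 * Real.cosh x + x * Real.sinh x - Real.cosh x) x :=
      ((hasDerivAt_id x).mul (Real.hasDerivAt_cosh x)).sub (Real.hasDerivAt_sinh x)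
    refine monotoneOn_of_hasDerivWithinAt_nonneg (convex_Ici 0)
      (fun x _ => (hd x).continuousAt.continuousWithinAt)
      (fun x _ => (hd x).hasDerivWithinAt) fun x hx => ?_
    have hx0 : 0 ≤ x := interior_subset hx
    linarith [mul_nonneg hx0 (Real.sinh_nonneg_iff.2 hx0)]
  have := hmono Set.self_mem_Ici (Set.mem_Ici.2 ht) ht
  simp at this
  linarith

theorem mainTheorem10 (c d : ℝ) (hc : 1 < c) (hd : 0 < d) :
    ∃ C : ℝ, ∀ t β lam : ℝ, 0 ≤ t → 0 < β →
      ‖jacobiFunction (c * β + d) β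
            (Complex.I * (jacobiRho (c * β + d) β : ℂ) - (lam : ℂ)) t
          - Complex.exp (Complex.I * (lam : ℂ) *
              (Real.log (Real.sqrt (Real.cosh t ^ 2 + (1 / c) * Real.sinh t ^ 2)) : ℂ))‖
        ≤ C * (|lam| * min 1 t) / Real.sqrt β := by
  have hc0 : 0 < c := one_pos.trans hc
  set K := 2 + |1 - (2 * d + 1) / c| with hK
  have hK0 : 0 < K := by positivity
  refine ⟨K / Real.sqrt d + 2, fun t β lam ht hβ => ?_⟩
  have hα : 0 < c * β + d := by positivity
  rcases eq_or_ne lam 0 with rfl | hlam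
  · rw [jacobiFunction_I_mul_jacobiRho (by linarith)]
    simp
  rcases ht.eq_or_lt with rfl | ht0
  · obtain ⟨u, -, hu, hu0, -⟩ :=
      exists_jacobiFunction_equation (α := c * β + d) (β := β) lam (by linarith)
    rw [← hu, hu0]
    simp
  set m := min 1 t with hm
  have hm0 : 0 ≤ m := le_min zero_le_one ht
  have hm1 : m ≤ 1 := min_le_left _ _
  have hT0 : 0 ≤ Real.sinh t / Real.cosh t :=
    div_nonneg (Real.sinh_nonneg_iff.2 ht) (Real.cosh_pos t).le
  have hT2 : (Real.sinh t / Real.cosh t) ^ 2 ≤ m ^ 2 :=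
    pow_le_pow_left₀ hT0 (sinh_div_cosh_le_min ht) 2
  have hβα : β ≤ c * β + d := by nlinarith
  have hsβ := Real.sqrt_pos.2 hβ
  have hsd := Real.sqrt_pos.2 hd
  -- AM-GM: this turns `1/α` into `1/√β` uniformly as `β → 0`, and is where `1/√d` enters the
  -- constant.
  have hsα : Real.sqrt β * Real.sqrt d ≤ c * β + d := by
    nlinarith [Real.sq_sqrt hβ.le, Real.sq_sqrt hd.le, sq_nonneg (Real.sqrt β - Real.sqrt d)]
  set x := |lam| * m / Real.sqrt β with hx
  have hx0 : 0 ≤ x := by positivity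
  have hgoal : (K / Real.sqrt d + 2) * (|lam| * m) / Real.sqrt β = K / Real.sqrt d * x + 2 * x := by
    rw [hx]
    ring
  rw [hgoal]
  have hKx : 0 ≤ K / Real.sqrt d * x := by positivity
  -- The `λ²` part of the comparison bound is at most `x²`, useful only for `x ≤ 1`; for `x ≥ 1` the
  -- bound `1 + 1 ≤ 2x` is enough.
  rcases le_total x 1 with hx1 | hx1
  · refine (norm_jacobiFunction_sub_exp_le hc.le hd hβ hlam ht0).trans ?_
    rw [← hK]
    have hb1 : |lam| * K * m ^ 2 / (4 * (c * β + d)) ≤ K / Real.sqrt d * x := by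
      calc |lam| * K * m ^ 2 / (4 * (c * β + d)) ≤
            |lam| * K * m / (Real.sqrt β * Real.sqrt d) := by
            refine div_le_div₀ (by positivity) ?_ (by positivity) (by linarith)
            exact mul_le_mul_of_nonneg_left (by nlinarith) (by positivity)
        _ = K / Real.sqrt d * x := by
            rw [hx]
            field_simp
    have hb2 : |lam| * |lam| * m ^ 2 / (4 * (c * β + d)) ≤ x := by
      calc |lam| * |lam| * m ^ 2 / (4 * (c * β + d)) ≤ |lam| * |lam| * m ^ 2 / β := by
            gcongr
            linarith
        _ = x ^ 2 := by
            rw [hx, div_pow, Real.sq_sqrt hβ.le]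
            ring
        _ ≤ x := by nlinarith
    calc |lam| * (K + |lam|) / (4 * (c * β + d)) * (Real.sinh t / Real.cosh t) ^ 2 ≤
          |lam| * (K + |lam|) / (4 * (c * β + d)) * m ^ 2 := by gcongr
      _ = |lam| * K * m ^ 2 / (4 * (c * β + d)) + |lam| * |lam| * m ^ 2 / (4 * (c * β + d)) := by
          ring
      _ ≤ K / Real.sqrt d * x + 2 * x := by linarith
  · have hu := norm_jacobiFunction_le_one (α := c * β + d) (β := β) (by linarith) hβα hlam ht0
    have hv : ‖Complex.exp (Complex.I * (lam : ℂ) *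
        (Real.log (Real.sqrt (Real.cosh t ^ 2 + (1 / c) * Real.sinh t ^ 2)) : ℂ))‖ = 1 := by
      rw [mul_assoc, mul_comm, ← Complex.ofReal_mul]
      exact Complex.norm_exp_ofReal_mul_I _
    refine (norm_sub_le _ _).trans ?_
    rw [hv]
    linarith
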